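/- Let $d\ge 1$. Let $\pi:\mathbb{R}^d\to\mathbb{R}$ be a measurable (possibly unnormalised) target density that is bounded, bounded below by a positive constant on every compact set, differentiable at every $x$ with $\|x\|\ge R$ for some $R<\infty$, and has regular contours, that is, $$\limsup_{\|x\|\to\infty}\frac{x}{\|x\|}\cdot\frac{\nabla\pi(x)}{\|\nabla\pi(x)\|}<0$$ (in particular $\nabla\pi(x)\ne 0$ for all sufficiently large $\|x\|$). For a probability density $q$ on $\mathbb{R}^d$ let $P_q$ be the Metropolis kernel $$P_q(x,A)=\mathbf 1_A(x)\Big[1-\int\min\Big\{1,\frac{\pi(y)}{\pi(x)}\Big\}q(y-x)\,dy\Big]+\int_A\min\Big\{1,\frac{\pi(y)}{\pi(x)}\Big\}q(y-x)\,dy .$$ Let $\tilde q$ and $q_{\mathrm{fix}}$ be symmetric probability densities on $\mathbb{R}^d$, $\tilde q(-z)=\tilde q(z)$ and $q_{\mathrm{fix}}(-z)=q_{\mathrm{fix}}(z)$, such that $q_{\mathrm{fix}}$ is bounded below by a positive constant on some neighbourhood of the origin. Let $\theta>0$ and $\beta\in(0,1)$, and for a positive definite matrix $s\in\mathbb{R}^{d\times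 d}$ put $$q_s(z)=(1-\beta)\det(\theta s)^{-1/2}\,\tilde q(\theta^{-1/2}s^{-1/2}z)+\beta\, q_{\mathrm{fix}}(z).$$ Let $(\eta_n)_{n\ge2}\subset(0,1)$ satisfy $\lim_{n\to\infty}\eta_{n+1}/\eta_n=1$, $\sum_{n\ge2}\eta_n=\infty$ and $\sum_{n\ge2}\eta_n^2<\infty$. Let $(X_n,M_n,S_n)_{n\ge1}$ be an Adaptive Metropolis process: a random process with deterministic initial values $X_1=x_1\in\mathbb{R}^d$, $M_1=m_1\in\mathbb{R}^d$, $S_1=s_1$ a positive definite matrix, such that for all $n\ge1$, with $\mathcal F_n=\sigma(X_k,M_k,S_k:1\le k\le n)$, $$\mathbb P(X_{n+1}\in A\mid\mathcal F_n)=P_{q_{S_n}}(X_n,A)\ \text{ a.s. for every measurable }A\subset\mathbb{R}^d,$$ $$M_{n+1}=(1-\eta_{n+1})M_n+\eta_{n+1}X_{n+1},\qquad S_{n+1}=(1-\eta_{n+1})S_n+\eta_{n+1}(X_{n+1}-M_n)(X_{n+1}-M_n)^T .$$ Then, almost surely, $$\liminf_{n\to\infty}\ \inf_{\|w\|=1}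 w^TS_nw>0 .$$ -/

import Mathlib

open MeasureTheory ProbabilityTheory Filter Topology
open scoped Matrix

noncomputable section

namespace AdaptiveMetropolis

/-- The space `ℝ^d` with its Euclidean norm. -/
abbrev E (d : ℕ) : Type := EuclideanSpace ℝ (Fin d)

/-- Real `d × d` matrices. -/
abbrev Mat (d : ℕ) : Type := Matrix (Fin d) (Fin d) ℝ

/-- A symmetric probability density `q` on `ℝ^d` (with respect to Lebesgue measure). -/
structure IsSymmetricDensity {d : ℕ} (q : E d → ℝ) : Prop where
  measurable : Measurable q
  nonneg : ∀ z, 0 ≤ q z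
  integrable : Integrable q volume
  integral_eq_one : ∫ z, q z = 1
  symm : ∀ z, q (-z) = q z

/-- The Metropolis transition kernel `P_q(x, A)` with target `π` and increment density `q`. -/
def metropolis {d : ℕ} (π q : E d → ℝ) (x : E d) (A : Set (E d)) : ℝ :=
  A.indicator (fun _ => (1 : ℝ)) x * (1 - ∫ y, min 1 (π y / π x) * q (y - x))
    + ∫ y in A, min 1 (π y / π x) * q (y - x)

/-- `s^{-1/2}` for a positive definite matrix `s`: the function `t ↦ t^{-1/2}` applied to `s`
through the spectral functional calculus. -/
def invSqrt {d : ℕ} (s : Mat d) : Mat d :=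
  cfc (fun t : ℝ => t ^ (-(1 / 2) : ℝ)) s

/-- The adaptive proposal density
`q̃_s(z) = det(θ s)^{-1/2} q̃(θ^{-1/2} s^{-1/2} z)` with template density `q̃`. -/
def adaptiveDensity {d : ℕ} (qt : E d → ℝ) (θ : ℝ) (s : Mat d) (z : E d) : ℝ :=
  (θ • s).det ^ (-(1 / 2) : ℝ)
    * qt (θ ^ (-(1 / 2) : ℝ) • WithLp.toLp 2 (invSqrt s *ᵥ z.ofLp))

/-- The mixture proposal density `q_s = (1 - β) q̃_s + β q_fix`. -/
def mixtureDensity {d : ℕ} (qt qfix : E d → ℝ) (θ β : ℝ) (s : Mat d) (z : E d) : ℝ :=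
  (1 - β) * adaptiveDensity qt θ s z + β * qfix z

/-- The `σ`-algebra `F_n = σ(X_k, M_k, S_k : 1 ≤ k ≤ n)`. -/
@[reducible]
def history {d : ℕ} {Ω : Type*} (X M : ℕ → Ω → E d) (S : ℕ → Ω → Mat d) (n : ℕ) :
    MeasurableSpace Ω :=
  ⨆ k ∈ Set.Icc 1 n,
    MeasurableSpace.comap (fun ω => (X k ω, M k ω, fun i j => S k ω i j))
      (inferInstance : MeasurableSpace (E d × E d × (Fin d → Fin d → ℝ)))

/-- `(X_n, M_n, S_n)_{n ≥ 1}` is an Adaptive Metropolis process on `(Ω, P)` with target `π`,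
template density `qt`, fixed proposal density `qfix`, scaling `θ`, mixing weight `β`, adaptation
weights `(η_n)_{n ≥ 2}` and deterministic initial values `x₁, m₁, s₁`.
The values of the sequences at the index `0` play no role. -/
structure IsAMProcess {d : ℕ} {Ω : Type*} [MeasurableSpace Ω] (P : Measure Ω)
    (π qt qfix : E d → ℝ) (θ β : ℝ) (η : ℕ → ℝ) (x₁ m₁ : E d) (s₁ : Mat d)
    (X M : ℕ → Ω → E d) (S : ℕ → Ω → Mat d) : Prop where
  measurable_X : ∀ n, 1 ≤ n → Measurable (X n)
  init_X : ∀ ω, X 1 ω = x₁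
  init_M : ∀ ω, M 1 ω = m₁
  init_S : ∀ ω, S 1 ω = s₁
  /-- `P(X_{n+1} ∈ A | F_n) = P_{q_{S_n}}(X_n, A)` almost surely. -/
  step_X : ∀ n, 1 ≤ n → ∀ A : Set (E d), MeasurableSet A →
    P[(X (n + 1) ⁻¹' A).indicator (fun _ => (1 : ℝ)) | history X M S n]
      =ᵐ[P] fun ω => metropolis π (mixtureDensity qt qfix θ β (S n ω)) (X n ω) A
  step_M : ∀ n, 1 ≤ n → ∀ ω,
    M (n + 1) ω = (1 - η (n + 1)) • M n ω + η (n + 1) • X (n + 1) ω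
  step_S : ∀ n, 1 ≤ n → ∀ ω,
    S (n + 1) ω = (1 - η (n + 1)) • S n ω
      + η (n + 1) • Matrix.vecMulVec (X (n + 1) ω - M n ω).ofLp (X (n + 1) ω - M n ω).ofLp

/-- `π` is differentiable in the tails and has regular contours:
`limsup_{‖x‖ → ∞} (x / ‖x‖) · (∇π(x) / ‖∇π(x)‖) < 0`.
Where `∇π(x) = 0` the quotient is read as `0`, so the inequality forces `∇π(x) ≠ 0` for all
large `‖x‖`. -/
structure HasRegularContours {d : ℕ} (π : E d → ℝ) : Prop where
  differentiable_tails : ∃ R : ℝ, ∀ x : E d, R ≤ ‖x‖ → DifferentiableAt ℝ π x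
  limsup_neg :
    limsup (fun x : E d =>
      ((inner ℝ (‖x‖⁻¹ • x) (‖gradient π x‖⁻¹ • gradient π x) : ℝ) : EReal))
      (Bornology.cobounded (E d)) < 0

end AdaptiveMetropolis

end

/-!
Fix a unit vector `w` and write `V n = wᵀ S n w` and `Z n = ⟪w, X (n + 1) - M n⟫`. The covariance
recursion gives `V (n + 1) = (1 - η (n + 1)) V n + η (n + 1) (Z n)²`, so `V` is a weighted running
average of the values `(Z n)²`, and it has to be shown that these are often bounded away from zero.

The mean recursion gives `Z n = ⟪w, X (n + 1) - X n⟫ + (1 - η n) Z (n - 1)`: if the chain moves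
by at least `δ` in the direction `w`, one of `|Z n|`, `|Z (n - 1)|` is at least `δ / 2`. Since
consecutive weights are comparable, it is enough to count such moves
(`exists_forall_le_of_variance_recursion`).

Such a move has conditional probability bounded below, whatever the past
(`exists_le_metropolis_separated`). The fixed component of the proposal is bounded below near the
origin. In the tails, regular contours make the target increase along all rays in a cone around the
direction of the origin, so that proposals in this cone are accepted
(`HasRegularContours.exists_le_sub_smul`); on compact sets the acceptance probability is trivially
bounded below. As the one-step law is given only for fixed sets, the current state is frozen at the
points of a countable dense set (`ae_le_condExp_indicator_of_frozen`).

The difference between the indicators of the moves and their conditional probabilities, weighted by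
`η`, is a martingale bounded in `L²` because `∑ η²` converges
(`ae_exists_tendsto_sum_sub_condExp`). A stochastic approximation argument then bounds `V n` from
below (`exists_forall_half_le_of_recursion`). All bounds are uniform over the directions near the
points of a finite net of the sphere, if the moves counted are also required to be bounded.
-/

open MeasureTheory ProbabilityTheory Filter Topology
open scoped Matrix

namespace AdaptiveMetropolis

/-! ### A stochastic approximation recursion -/

/-- A sequence that is pulled towards `ε + ξ n` with step sizes `a n` of infinite sum is eventually
above `ε / 2`, provided that the weighted noise `∑ a n * ξ n` converges. -/
lemma eventually_half_le_of_recursion {a ξ u : ℕ → ℝ} (ha : ∀ n, a n ∈ Set.Ioo (0 : ℝ) 1)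
    (ha_sum : ¬ Summable a) {l : ℝ}
    (hξ : Tendsto (fun n => ∑ k ∈ Finset.range n, a k * ξ k) atTop (𝓝 l))
    {ε : ℝ} (hε : 0 < ε) (N₀ : ℕ)
    (hu : ∀ n, N₀ ≤ n → (1 - a n) * u n + a n * (ε + ξ n) ≤ u (n + 1)) :
    ∀ᶠ n in atTop, ε / 2 ≤ u n := by
  have hclose : ∀ᶠ n in atTop, |(∑ k ∈ Finset.range n, a k * ξ k) - l| < ε / 8 := by
    have := (Metric.tendsto_nhds.1 hξ) (ε / 8) (by positivity)
    simpa [Real.dist_eq] using this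
  obtain ⟨N₁, hN₁⟩ := eventually_atTop.1 (hclose.and (eventually_ge_atTop N₀))
  -- adding the tail of the noise series removes the noise from the recursion
  set D : ℕ → ℝ := fun n => u n + (l - ∑ k ∈ Finset.range n, a k * ξ k) - 3 * ε / 4 with hD
  have hstep : ∀ n, N₁ ≤ n → (1 - a n) * D n ≤ D (n + 1) := by
    intro n hn
    obtain ⟨h1, h2⟩ := hN₁ n hn
    have h3 := hu n h2
    have h4 := (abs_lt.1 h1).2
    have h5 := mul_nonneg (ha n).1.le
      (by linarith : 0 ≤ ε / 4 + (l - ∑ k ∈ Finset.range n, a k * ξ k))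
    simp only [hD, Finset.sum_range_succ]
    nlinarith
  have hprod : ∀ j, (∏ i ∈ Finset.range j, (1 - a (N₁ + i))) * (-|D N₁|) ≤ D (N₁ + j) := by
    intro j
    induction j with
    | zero => simpa using neg_abs_le (D N₁)
    | succ j ih =>
      rw [Finset.prod_range_succ, ← add_assoc]
      refine le_trans ?_ (hstep (N₁ + j) (by omega))
      nlinarith [mul_le_mul_of_nonneg_left ih (by linarith [(ha (N₁ + j)).2] :
        0 ≤ 1 - a (N₁ + j))]
  have hsum : Tendsto (fun j => ∑ i ∈ Finset.range j, a (N₁ + i)) atTop atTop := by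
    rw [← not_summable_iff_tendsto_nat_atTop_of_nonneg fun i => (ha _).1.le]
    simpa [add_comm] using (not_congr (summable_nat_add_iff (f := a) N₁)).2 ha_sum
  have hlim : Tendsto (fun j => ∏ i ∈ Finset.range j, (1 - a (N₁ + i))) atTop (𝓝 0) := by
    refine squeeze_zero (fun j => Finset.prod_nonneg fun i _ => by linarith [(ha (N₁ + i)).2])
      (fun j => ?_) (Real.tendsto_exp_neg_atTop_nhds_zero.comp hsum)
    rw [Function.comp, ← Finset.sum_neg_distrib, Real.exp_sum]
    refine Finset.prod_le_prod (fun i _ => by linarith [(ha (N₁ + i)).2]) fun i _ => ?_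
    linarith [Real.add_one_le_exp (-a (N₁ + i))]
  have hlim' := hlim.mul_const (-|D N₁|)
  rw [zero_mul] at hlim'
  have hev := (hlim'.eventually (lt_mem_nhds (by linarith : -(ε / 8) < 0)))
  obtain ⟨J, hJ⟩ := eventually_atTop.1 hev
  refine eventually_atTop.2 ⟨N₁ + J, fun n hn => ?_⟩
  obtain ⟨j, rfl⟩ := Nat.exists_eq_add_of_le (show N₁ ≤ n by omega)
  have h1 := hJ j (by omega)
  have h2 := hprod j
  have h3 := (abs_lt.1 (hN₁ (N₁ + j) (by omega)).1).1
  simp only [hD] at h2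
  simp only [hD] at h1
  linarith

/-- `eventually_half_le_of_recursion`, uniformly over all sequences whose value at the starting
index has a common lower bound. -/
lemma exists_forall_half_le_of_recursion {a ξ : ℕ → ℝ} (ha : ∀ n, a n ∈ Set.Ioo (0 : ℝ) 1)
    (ha_sum : ¬ Summable a) {l : ℝ}
    (hξ : Tendsto (fun n => ∑ k ∈ Finset.range n, a k * ξ k) atTop (𝓝 l))
    {ε : ℝ} (hε : 0 < ε) (N₀ : ℕ) (K : ℝ) :
    ∃ N, ∀ W : ℕ → ℝ, K ≤ W N₀ →
      (∀ n, N₀ ≤ n → (1 - a n) * W n + a n * (ε + ξ n) ≤ W (n + 1)) →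
      ∀ n, N ≤ n → ε / 2 ≤ W n := by
  -- the smallest sequence that satisfies the hypotheses
  set v : ℕ → ℝ := fun j => Nat.rec K
    (fun j y => (1 - a (N₀ + j)) * y + a (N₀ + j) * (ε + ξ (N₀ + j))) j with hv
  have hv_succ : ∀ j, v (j + 1) = (1 - a (N₀ + j)) * v j + a (N₀ + j) * (ε + ξ (N₀ + j)) :=
    fun j => rfl
  have hev := eventually_half_le_of_recursion (u := fun n => v (n - N₀)) ha ha_sum hξ hε N₀ (by
    intro n hn
    obtain ⟨j, rfl⟩ := Nat.exists_eq_add_of_le hn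
    simp only [add_tsub_cancel_left, add_assoc, hv_succ, le_refl])
  obtain ⟨N, hN⟩ := eventually_atTop.1 hev
  refine ⟨N + N₀, fun W hW hrec n hn => ?_⟩
  have hcomp : ∀ j, v j ≤ W (N₀ + j) := by
    intro j
    induction j with
    | zero => simpa [hv] using hW
    | succ j ih =>
      rw [hv_succ, ← add_assoc]
      refine le_trans ?_ (hrec (N₀ + j) (by omega))
      gcongr
      linarith [(ha (N₀ + j)).2]
  have h1 := hN n (by omega)
  have h2 := hcomp (n - N₀)
  rw [Nat.add_sub_cancel' (by omega)] at h2
  exact h1.trans h2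

/-! ### Convergence of weighted sums of martingale differences -/

/-- The centred sums of bounded random variables with square-summable weights converge almost
surely: they form a martingale that is bounded in `L²`. -/
lemma ae_exists_tendsto_sum_sub_condExp {Ω : Type*} {m0 : MeasurableSpace Ω} {P : Measure Ω}
    [IsProbabilityMeasure P] (ℱ : Filtration ℕ m0) {f : ℕ → Ω → ℝ}
    (hf : ∀ n, StronglyMeasurable[ℱ (n + 1)] (f n)) (hb : ∀ n ω, |f n ω| ≤ 1)
    {a : ℕ → ℝ} (ha : Summable fun n => a n ^ 2) :
    ∀ᵐ ω ∂P, ∃ l, Tendsto (fun n => ∑ k ∈ Finset.range n, a k * (f k ω - P[f k|ℱ k] ω))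
      atTop (𝓝 l) := by
  set g : ℕ → Ω → ℝ := fun k ω => a k * (f k ω - P[f k|ℱ k] ω) with hg
  set Y : ℕ → Ω → ℝ := fun n ω => ∑ k ∈ Finset.range n, g k ω with hY
  have hfint : ∀ n, Integrable (f n) P := fun n =>
    Integrable.of_bound ((hf n).mono (ℱ.le _)).aestronglyMeasurable 1 (ae_of_all _ (hb n))
  have hgm : ∀ n, StronglyMeasurable[ℱ (n + 1)] (g n) := fun n =>
    ((hf n).sub (stronglyMeasurable_condExp.mono (ℱ.mono n.le_succ))).const_mul (a n)
  have hgb : ∀ n, ∀ᵐ ω ∂P, |g n ω| ≤ 2 * |a n| := by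
    intro n
    have := ae_bdd_abs_condExp_of_ae_bdd_abs (m := ℱ n) (ae_of_all P (hb n))
    filter_upwards [this] with ω hω
    rw [hg, abs_mul, mul_comm]
    have h1 := abs_sub (f n ω) (P[f n|ℱ n] ω)
    have h2 := hb n ω
    gcongr
    linarith
  have hgint : ∀ n, Integrable (g n) P := fun n =>
    ((hfint n).sub integrable_condExp).const_mul (a n)
  have hgcond : ∀ n, P[g n|ℱ n] =ᵐ[P] 0 := by
    intro n
    have h1 : P[g n|ℱ n] =ᵐ[P] a n • P[f n - P[f n|ℱ n]|ℱ n] :=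
      condExp_smul (a n) (f n - P[f n|ℱ n]) (ℱ n)
    have h2 := condExp_sub (hfint n) (integrable_condExp (m := ℱ n) (f := f n) (μ := P)) (ℱ n)
    have h3 : P[P[f n|ℱ n]|ℱ n] = P[f n|ℱ n] :=
      condExp_of_stronglyMeasurable (ℱ.le n) stronglyMeasurable_condExp integrable_condExp
    filter_upwards [h1, h2] with ω h1 h2
    rw [h1, Pi.smul_apply, h2, h3]
    simp
  have hYm : ∀ n, StronglyMeasurable[ℱ n] (Y n) := by
    intro n
    have : Y n = ∑ k ∈ Finset.range n, g k := by ext ω; simp [hY]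
    rw [this]
    exact Finset.stronglyMeasurable_sum _ fun k hk =>
      (hgm k).mono (ℱ.mono (Finset.mem_range.1 hk))
  have hYb : ∀ n, ∀ᵐ ω ∂P, ‖Y n ω‖ ≤ ∑ k ∈ Finset.range n, 2 * |a k| := by
    intro n
    filter_upwards [ae_all_iff.2 hgb] with ω hω
    exact (Finset.abs_sum_le_sum_abs _ _).trans (Finset.sum_le_sum fun k _ => hω k)
  have hYint : ∀ n, Integrable (Y n) P := fun n =>
    integrable_finsetSum _ fun k _ => hgint k
  have hYsucc : ∀ n, Y (n + 1) = Y n + g n := by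
    intro n; ext ω; simp [hY, Finset.sum_range_succ]
  have hmart : Martingale Y ℱ P := by
    refine martingale_nat hYm hYint fun n => ?_
    have h1 := condExp_add (hYint n) (hgint n) (ℱ n)
    have h2 : P[Y n|ℱ n] = Y n := condExp_of_stronglyMeasurable (ℱ.le n) (hYm n) (hYint n)
    rw [hYsucc]
    filter_upwards [h1, hgcond n] with ω h1 h3
    simp [h1, h2, h3]
  have hYg : ∀ n, Integrable (Y n * g n) P := fun n =>
    (hgint n).bdd_mul ((hYm n).mono (ℱ.le n)).aestronglyMeasurable (hYb n)
  have hcross : ∀ n, ∫ ω, (Y n * g n) ω ∂P = 0 := by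
    intro n
    rw [← integral_condExp (ℱ.le n)]
    have h1 := condExp_mul_of_stronglyMeasurable_left (hYm n) (hYg n) (hgint n)
    rw [integral_congr_ae h1]
    refine integral_eq_zero_of_ae ?_
    filter_upwards [hgcond n] with ω hω
    simp [hω]
  have hgg : ∀ n, Integrable (fun ω => g n ω ^ 2) P := fun n => by
    simp_rw [pow_two]
    exact (hgint n).bdd_mul (hgint n).aestronglyMeasurable (hgb n)
  have hYY : ∀ n, Integrable (fun ω => Y n ω ^ 2) P := fun n => by
    simp_rw [pow_two]
    exact (hYint n).bdd_mul (hYint n).aestronglyMeasurable (hYb n)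
  have hL2 : ∀ n, ∫ ω, Y n ω ^ 2 ∂P ≤ ∑ k ∈ Finset.range n, 4 * a k ^ 2 := by
    intro n
    induction n with
    | zero => simp [hY]
    | succ n ih =>
      have h1 : ∫ ω, Y (n + 1) ω ^ 2 ∂P = ∫ ω, Y n ω ^ 2 ∂P + ∫ ω, g n ω ^ 2 ∂P := by
        have h2 : ∀ ω, Y (n + 1) ω ^ 2 = Y n ω ^ 2 + (2 * (Y n * g n) ω + g n ω ^ 2) := by
          intro ω; rw [hYsucc]; simp only [Pi.add_apply, Pi.mul_apply]; ring
        have h3 : Integrable (fun ω => 2 * (Y n * g n) ω) P := (hYg n).const_mul 2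
        have h4 : Integrable (fun ω => 2 * (Y n * g n) ω + g n ω ^ 2) P := h3.add (hgg n)
        simp_rw [h2]
        rw [integral_add (hYY n) h4, integral_add h3 (hgg n), integral_const_mul,
          hcross, mul_zero, zero_add]
      rw [h1, Finset.sum_range_succ]
      have h2 : ∫ ω, g n ω ^ 2 ∂P ≤ ∫ _, 4 * a n ^ 2 ∂P := by
        refine integral_mono_ae (hgg n) (integrable_const _) ?_
        filter_upwards [hgb n] with ω hω
        calc g n ω ^ 2 = |g n ω| ^ 2 := (sq_abs _).symm
          _ ≤ (2 * |a n|) ^ 2 := pow_le_pow_left₀ (abs_nonneg _) hω 2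
          _ = 4 * a n ^ 2 := by rw [mul_pow, sq_abs]; norm_num
      simp only [integral_const, probReal_univ, smul_eq_mul, one_mul] at h2
      linarith
  have hL1 : ∀ n, eLpNorm (Y n) 1 P ≤ (1 + ∑' k, 4 * a k ^ 2).toNNReal := by
    intro n
    rw [eLpNorm_one_eq_lintegral_enorm, ← ofReal_integral_norm_eq_lintegral_enorm (hYint n)]
    refine ENNReal.ofReal_le_ofReal ?_
    calc ∫ ω, ‖Y n ω‖ ∂P ≤ ∫ ω, (1 + Y n ω ^ 2) ∂P := by
          refine integral_mono (hYint n).norm ((integrable_const _).add (hYY n)) fun ω => ?_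
          rw [Real.norm_eq_abs]
          nlinarith [sq_abs (Y n ω), sq_nonneg (|Y n ω| - 1), abs_nonneg (Y n ω)]
      _ = 1 + ∫ ω, Y n ω ^ 2 ∂P := by
          rw [integral_add (integrable_const _) (hYY n)]; simp
      _ ≤ _ := by
          gcongr
          exact (hL2 n).trans ((ha.mul_left 4).sum_le_tsum _ fun k _ => by positivity)
  exact hmart.submartingale.exists_ae_tendsto_of_bdd hL1

variable {d : ℕ}

/-! ### The acceptance probability on balls near the current state -/

/-- In the tails the cosine of the angle between the gradient and the outward direction is at most
`-κ` for a fixed `κ > 0`. The bound is multiplied by the norm of the gradient, so that no division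
by a possibly vanishing gradient occurs. -/
lemma HasRegularContours.exists_inner_gradient_le {π : E d → ℝ} (hπ : HasRegularContours π) :
    ∃ κ R : ℝ, 0 < κ ∧ κ ≤ 1 ∧ 0 < R ∧ ∀ y : E d, R ≤ ‖y‖ → DifferentiableAt ℝ π y ∧
      inner ℝ (‖y‖⁻¹ • y) (gradient π y) ≤ -κ * ‖gradient π y‖ := by
  obtain ⟨R₁, hR₁⟩ := hπ.differentiable_tails
  obtain ⟨b, hb, hb0⟩ := EReal.lt_iff_exists_real_btwn.1 hπ.limsup_neg
  have hev := eventually_lt_of_limsup_lt hb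
  rw [← comap_norm_atTop, eventually_comap] at hev
  obtain ⟨R₂, hR₂⟩ := eventually_atTop.1 hev
  have hb0' : b < 0 := by exact_mod_cast hb0
  refine ⟨min (-b) 1, max 1 (max R₁ R₂), lt_min (by linarith) one_pos, min_le_right _ _,
    lt_of_lt_of_le one_pos (le_max_left _ _), fun y hy => ⟨hR₁ y ?_, ?_⟩⟩
  · exact ((le_max_left _ _).trans (le_max_right _ _)).trans hy
  · have h1 := hR₂ ‖y‖ (((le_max_right _ _).trans (le_max_right _ _)).trans hy) y rfl
    have h2 : inner ℝ (‖y‖⁻¹ • y) (‖gradient π y‖⁻¹ • gradient π y) < b := by exact_mod_cast h1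
    rcases eq_or_ne (gradient π y) 0 with h0 | h0
    · simp [h0]
    · have hpos : 0 < ‖gradient π y‖ := norm_pos_iff.2 h0
      rw [inner_smul_right, inv_mul_lt_iff₀ hpos] at h2
      nlinarith [min_le_left (-b) 1]

lemma norm_normalized_sub_le {F : Type*} [NormedAddCommGroup F] [NormedSpace ℝ F] {x y : F}
    (hx : x ≠ 0) (hy : y ≠ 0) : ‖‖x‖⁻¹ • x - ‖y‖⁻¹ • y‖ ≤ 2 * ‖x - y‖ / ‖x‖ := by
  have hx' : 0 < ‖x‖ := norm_pos_iff.2 hx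
  have hy' : 0 < ‖y‖ := norm_pos_iff.2 hy
  have h1 : ‖x‖⁻¹ • x - ‖y‖⁻¹ • y = ‖x‖⁻¹ • (x - y) + (‖x‖⁻¹ - ‖y‖⁻¹) • y := by
    module
  have h2 : ‖(‖x‖⁻¹ - ‖y‖⁻¹) • y‖ = |‖y‖ - ‖x‖| / ‖x‖ := by
    rw [norm_smul, Real.norm_eq_abs, inv_sub_inv hx'.ne' hy'.ne', abs_div, abs_mul, abs_norm,
      abs_norm]
    field_simp
  rw [h1]
  refine (norm_add_le _ _).trans ?_
  rw [h2, norm_smul, norm_inv, norm_norm, inv_mul_eq_div, ← add_div]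
  gcongr
  have := abs_norm_sub_norm_le y x
  rw [norm_sub_rev] at this
  linarith

/-- Far from the origin the target increases along every ray that starts at `x` in a direction
close to that of `-x`. -/
lemma HasRegularContours.exists_le_sub_smul {π : E d → ℝ} (hπ : HasRegularContours π)
    {r : ℝ} (hr : 0 < r) :
    ∃ κ R : ℝ, 0 < κ ∧ κ ≤ 1 ∧ 0 < R ∧ ∀ x : E d, R ≤ ‖x‖ → ∀ u : E d,
      ‖u - ‖x‖⁻¹ • x‖ ≤ κ → ∀ ρ : ℝ, 0 ≤ ρ → ρ * ‖u‖ ≤ r → π x ≤ π (x - ρ • u) := by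
  obtain ⟨κ, R, hκ, hκ1, hR, hgrad⟩ := hπ.exists_inner_gradient_le
  refine ⟨κ / 2, R + r + 4 * r / κ, by positivity, by linarith, by positivity,
    fun x hx u hu ρ hρ hρu => ?_⟩
  have hx0 : 0 < ‖x‖ := lt_of_lt_of_le (by positivity) hx
  have hder : ∀ t ∈ Set.Icc 0 ρ, HasDerivAt (fun t : ℝ => π (x - t • u))
      (inner ℝ (gradient π (x - t • u)) (-u)) t ∧
      0 ≤ inner ℝ (gradient π (x - t • u)) (-u) := by
    intro t ht
    set y := x - t • u with hy
    have hxy : ‖x - y‖ ≤ r := by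
      rw [hy, sub_sub_cancel, norm_smul, Real.norm_of_nonneg ht.1]
      exact (mul_le_mul_of_nonneg_right ht.2 (norm_nonneg _)).trans hρu
    have hyR : R ≤ ‖y‖ := by
      have h1 := norm_sub_norm_le x y
      have h2 : 0 ≤ 4 * r / κ := by positivity
      linarith
    obtain ⟨hdiff, hin⟩ := hgrad y hyR
    constructor
    · have h1 : HasDerivAt (fun t : ℝ => x - t • u) (-u) t := by
        simpa using ((hasDerivAt_id t).smul_const u).const_sub x
      have h2 := hdiff.hasGradientAt.hasFDerivAt.comp_hasDerivAt t h1
      exact h2.congr_deriv (by simp)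
    · have h1 : ‖u - ‖y‖⁻¹ • y‖ ≤ κ := by
        have h2 := norm_normalized_sub_le (norm_pos_iff.1 hx0)
          (norm_pos_iff.1 (hR.trans_le hyR))
        have h3 : 2 * ‖x - y‖ / ‖x‖ ≤ κ / 2 := by
          rw [div_le_iff₀ hx0]
          have h4 : κ / 2 * (4 * r / κ) ≤ κ / 2 * ‖x‖ := by
            gcongr
            linarith
          have h5 : κ / 2 * (4 * r / κ) = 2 * r := by field_simp; norm_num
          linarith
        calc ‖u - ‖y‖⁻¹ • y‖ ≤ ‖u - ‖x‖⁻¹ • x‖ + ‖‖x‖⁻¹ • x - ‖y‖⁻¹ • y‖ :=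
              norm_sub_le_norm_sub_add_norm_sub _ _ _
          _ ≤ κ := by linarith
      have h2 : inner ℝ (gradient π y) u = inner ℝ (‖y‖⁻¹ • y) (gradient π y)
          + inner ℝ (gradient π y) (u - ‖y‖⁻¹ • y) := by
        rw [inner_sub_right, real_inner_comm (gradient π y)]; ring
      have h3 := real_inner_le_norm (gradient π y) (u - ‖y‖⁻¹ • y)
      have h4 := mul_le_mul_of_nonneg_left h1 (norm_nonneg (gradient π y))
      rw [inner_neg_right]
      linarith
  have hmono : MonotoneOn (fun t : ℝ => π (x - t • u)) (Set.Icc 0 ρ) := by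
    refine monotoneOn_of_deriv_nonneg (convex_Icc _ _)
      (fun t ht => (hder t ht).1.continuousAt.continuousWithinAt)
      (fun t ht => (hder t (interior_subset ht)).1.differentiableAt.differentiableWithinAt)
      fun t ht => ?_
    rw [(hder t (interior_subset ht)).1.deriv]
    exact (hder t (interior_subset ht)).2
  simpa using hmono (Set.left_mem_Icc.2 hρ) (Set.right_mem_Icc.2 hρ) hρ

/-- Every state has, within distance `r`, a ball of fixed radius on which the acceptance
probability is bounded below. In the tails this ball lies in a cone of increase of the target;
on compact sets it is centred at the state. -/
lemma HasRegularContours.exists_ball_le_min_div {π : E d → ℝ} (hπ : HasRegularContours π)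
    (hbdd : ∃ C : ℝ, ∀ x, π x ≤ C)
    (hpos : ∀ K : Set (E d), IsCompact K → ∃ c : ℝ, 0 < c ∧ ∀ x ∈ K, c ≤ π x)
    {r : ℝ} (hr : 0 < r) :
    ∃ m s : ℝ, 0 < m ∧ 0 < s ∧ ∀ x : E d, ∃ p : E d, ∀ z ∈ Metric.closedBall p s,
      ‖z‖ ≤ r ∧ m ≤ min 1 (π (x + z) / π x) := by
  obtain ⟨κ, R, hκ, hκ1, hR, hmono⟩ := hπ.exists_le_sub_smul hr
  obtain ⟨C, hC⟩ := hbdd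
  obtain ⟨c, hc, hcπ⟩ := hpos _ (isCompact_closedBall (0 : E d) (R + r))
  have hπ0 : ∀ x, 0 < π x := fun x => by
    obtain ⟨c', hc', h⟩ := hpos {x} isCompact_singleton
    exact hc'.trans_le (h x rfl)
  have hC0 : 0 < C := (hπ0 0).trans_le (hC 0)
  refine ⟨min 1 (c / C), r / 2 * κ, lt_min one_pos (by positivity), by positivity, fun x => ?_⟩
  rcases le_total R ‖x‖ with hx | hx
  · have hx0 : ‖x‖ ≠ 0 := (hR.trans_le hx).ne'
    refine ⟨-(r / 2) • ‖x‖⁻¹ • x, fun z hz => ?_⟩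
    obtain ⟨u, hu⟩ : ∃ u : E d, z = -(r / 2) • u := ⟨(-(r / 2))⁻¹ • z, by
      rw [smul_inv_smul₀ (by linarith : -(r / 2) ≠ 0)]⟩
    have h1 : ‖u - ‖x‖⁻¹ • x‖ ≤ κ := by
      rw [mem_closedBall_iff_norm, hu, ← smul_sub, norm_smul, norm_neg,
        Real.norm_of_nonneg (by positivity)] at hz
      exact le_of_mul_le_mul_left hz (by positivity)
    have h2 : r / 2 * ‖u‖ ≤ r := by
      have h3 := norm_le_norm_add_norm_sub' u (‖x‖⁻¹ • x)
      have h4 : ‖‖x‖⁻¹ • x‖ = 1 := by rw [norm_smul, norm_inv, norm_norm, inv_mul_cancel₀ hx0]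
      nlinarith
    refine ⟨?_, le_min (min_le_left _ _) ((min_le_left _ _).trans ?_)⟩
    · rwa [hu, norm_smul, norm_neg, Real.norm_of_nonneg (by positivity)]
    · rw [one_le_div (hπ0 x), hu, neg_smul, ← sub_eq_add_neg]
      exact hmono x hx u h1 _ (by positivity) h2
  · refine ⟨0, fun z hz => ?_⟩
    rw [mem_closedBall_zero_iff] at hz
    have h1 : ‖z‖ ≤ r := hz.trans (by nlinarith)
    refine ⟨h1, le_min (min_le_left _ _) ((min_le_right _ _).trans ?_)⟩
    have h2 : x + z ∈ Metric.closedBall (0 : E d) (R + r) := by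
      rw [mem_closedBall_zero_iff]
      exact (norm_add_le _ _).trans (add_le_add hx h1)
    exact div_le_div₀ (hπ0 _).le (hcπ _ h2) (hπ0 x) (hC x)

/-- A ball contains a ball of a quarter of its radius that stays away from the hyperplane
orthogonal to a given unit vector. -/
lemma exists_closedBall_subset_le_abs_inner (p : E d) {w : E d} (hw : ‖w‖ = 1) {s : ℝ}
    (hs : 0 < s) : ∃ p' : E d, ∀ z ∈ Metric.closedBall p' (s / 4),
      z ∈ Metric.closedBall p s ∧ s / 4 ≤ |inner ℝ w z| := by
  obtain ⟨σ, hσ, hσp⟩ : ∃ σ : ℝ, |σ| = 1 ∧ 0 ≤ σ * inner ℝ w p := by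
    rcases le_total 0 (inner ℝ w p) with h | h
    · exact ⟨1, by simp, by simpa using h⟩
    · exact ⟨-1, by simp, by simpa using h⟩
  refine ⟨p + (σ * (s / 2)) • w, fun z hz => ?_⟩
  have hnorm : ‖(σ * (s / 2)) • w‖ = s / 2 := by
    rw [norm_smul, hw, Real.norm_eq_abs, abs_mul, hσ, abs_of_pos (by positivity)]; ring
  rw [mem_closedBall_iff_norm] at hz ⊢
  have hdec : z = p + (σ * (s / 2)) • w + (z - (p + (σ * (s / 2)) • w)) := by abel
  set e := z - (p + (σ * (s / 2)) • w) with he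
  refine ⟨?_, ?_⟩
  · have h1 : z - p = (σ * (s / 2)) • w + e := by rw [he]; abel
    rw [h1]
    refine (norm_add_le _ _).trans ?_
    linarith
  · have hee : |inner ℝ w e| ≤ s / 4 := by
      refine (abs_real_inner_le_norm w e).trans ?_
      rw [hw, one_mul]; exact hz
    have h1 : σ * inner ℝ w z = σ * inner ℝ w p + s / 2 + σ * inner ℝ w e := by
      rw [hdec, inner_add_right, inner_add_right, inner_smul_right, real_inner_self_eq_norm_sq, hw]
      have : σ * σ = 1 := by rw [← abs_mul_abs_self, hσ, one_mul]
      linear_combination (s / 2) * this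
    have h2 : |σ * inner ℝ w e| ≤ s / 4 := by rw [abs_mul, hσ, one_mul]; exact hee
    have h3 : |inner ℝ w z| = |σ * inner ℝ w z| := by rw [abs_mul, hσ, one_mul]
    rw [h3, h1]
    refine le_trans ?_ (le_abs_self _)
    linarith [(abs_le.1 h2).1]

/-! ### The proposal densities and the Metropolis kernel -/

lemma exists_mul_invSqrt_eq_one {s : Mat d} (hs : s.PosDef) : ∃ B : Mat d, B * invSqrt s = 1 := by
  have hfin : (spectrum ℝ s).Finite := Matrix.finite_real_spectrum
  refine ⟨cfc (fun t : ℝ => t ^ (1 / 2 : ℝ)) s, ?_⟩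
  rw [invSqrt, ← cfc_mul _ _ s (hfin.continuousOn _) (hfin.continuousOn _),
    ← cfc_one ℝ s hs.isHermitian.isSelfAdjoint]
  refine cfc_congr fun t ht => ?_
  have ht0 : 0 < t := by
    rw [hs.1.spectrum_real_eq_range_eigenvalues] at ht
    obtain ⟨i, rfl⟩ := ht
    exact hs.eigenvalues_pos i
  simp only [Pi.one_apply]
  rw [← Real.rpow_add ht0]; norm_num

/-- Integrability is what makes the integrals in the Metropolis kernel meaningful; it rests on the
invertibility of `s^{-1/2}`. -/
lemma IsSymmetricDensity.integrable_adaptiveDensity {qt : E d → ℝ} (hqt : IsSymmetricDensity qt)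
    {θ : ℝ} (hθ : 0 < θ) {s : Mat d} (hs : s.PosDef) :
    Integrable (adaptiveDensity qt θ s) volume := by
  set c : ℝ := θ ^ (-(1 / 2) : ℝ) with hc
  have hc0 : c ≠ 0 := (Real.rpow_pos_of_pos hθ _).ne'
  let L : E d →ₗ[ℝ] E d := c • Matrix.toEuclideanLin (invSqrt s)
  have hLdet : LinearMap.det L ≠ 0 := by
    intro h0
    obtain ⟨v, hv, hv0⟩ := (Submodule.ne_bot_iff _).1 (LinearMap.bot_lt_ker_of_det_eq_zero h0).ne'
    obtain ⟨B, hB⟩ := exists_mul_invSqrt_eq_one hs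
    have h1 : c • Matrix.toEuclideanLin (invSqrt s) v = 0 := hv
    rw [smul_eq_zero, or_iff_right hc0] at h1
    have h2 : invSqrt s *ᵥ v.ofLp = 0 := congrArg WithLp.ofLp h1
    have h3 : B *ᵥ (invSqrt s *ᵥ v.ofLp) = 0 := by rw [h2, Matrix.mulVec_zero]
    rw [Matrix.mulVec_mulVec, hB, Matrix.one_mulVec] at h3
    exact hv0 (by ext i; simpa using congrFun h3 i)
  have hL : Integrable (fun z => qt (L z)) volume := by
    have hmeas : Measurable L := L.continuous_of_finiteDimensional.measurable
    refine Integrable.comp_measurable ?_ hmeas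
    rw [Measure.map_linearMap_addHaar_eq_smul_addHaar volume hLdet]
    exact hqt.integrable.smul_measure ENNReal.ofReal_ne_top
  exact hL.const_mul _

lemma IsSymmetricDensity.adaptiveDensity_nonneg {qt : E d → ℝ} (hqt : IsSymmetricDensity qt)
    {θ : ℝ} (hθ : 0 < θ) {s : Mat d} (hs : s.PosDef) (z : E d) : 0 ≤ adaptiveDensity qt θ s z :=
  mul_nonneg (Real.rpow_nonneg (hs.smul hθ).det_pos.le _) (hqt.nonneg _)

/-- The fixed component of the proposal bounds the Metropolis kernel from below on sets that do
not contain the current state. -/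
lemma le_metropolis_mixtureDensity {π qt qfix : E d → ℝ} (hπ_meas : Measurable π)
    (hπ0 : ∀ x, 0 < π x) (hqt : IsSymmetricDensity qt) (hqfix : IsSymmetricDensity qfix)
    {θ β : ℝ} (hθ : 0 < θ) (hβ : β ∈ Set.Ioo (0 : ℝ) 1) {s : Mat d} (hs : s.PosDef)
    {x : E d} {A : Set (E d)} (hxA : x ∉ A) {p : E d} {τ c m : ℝ}
    (hc : 0 ≤ c)
    (hball : ∀ z ∈ Metric.closedBall p τ,
      x + z ∈ A ∧ c ≤ qfix z ∧ m ≤ min 1 (π (x + z) / π x)) :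
    m * (β * c) * volume.real (Metric.closedBall (0 : E d) τ)
      ≤ metropolis π (mixtureDensity qt qfix θ β s) x A := by
  have hq : Integrable (mixtureDensity qt qfix θ β s) volume :=
    ((hqt.integrable_adaptiveDensity hθ hs).const_mul _).add (hqfix.integrable.const_mul _)
  have hmin : ∀ y, 0 ≤ min 1 (π y / π x) := fun y =>
    le_min zero_le_one (div_pos (hπ0 y) (hπ0 x)).le
  have hqle : ∀ z, β * qfix z ≤ mixtureDensity qt qfix θ β s z := fun z =>
    le_add_of_nonneg_left (mul_nonneg (by linarith [hβ.2]) (hqt.adaptiveDensity_nonneg hθ hs z))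
  have hint : Integrable (fun y => min 1 (π y / π x) * mixtureDensity qt qfix θ β s (y - x))
      volume := by
    refine (hq.comp_sub_right x).bdd_mul (c := 1)
      (measurable_const.min (hπ_meas.div_const _)).aestronglyMeasurable
      (ae_of_all _ fun y => ?_)
    rw [Real.norm_of_nonneg (hmin y)]
    exact min_le_left _ _
  have hnn : ∀ y, 0 ≤ min 1 (π y / π x) * mixtureDensity qt qfix θ β s (y - x) := fun y =>
    mul_nonneg (hmin y) ((mul_nonneg hβ.1.le (hqfix.nonneg _)).trans (hqle _))
  have hsub : ∀ y ∈ Metric.closedBall (x + p) τ, y - x ∈ Metric.closedBall p τ := by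
    intro y hy
    rw [mem_closedBall_iff_norm] at hy ⊢
    rwa [sub_sub]
  have hvol : volume.real (Metric.closedBall (0 : E d) τ)
      = volume.real (Metric.closedBall (x + p) τ) := by
    simp only [Measure.real, Measure.addHaar_closedBall_center]
  rw [metropolis, Set.indicator_of_notMem hxA, zero_mul, zero_add, hvol]
  calc m * (β * c) * volume.real (Metric.closedBall (x + p) τ)
      = ∫ _ in Metric.closedBall (x + p) τ, m * (β * c) := by
        rw [setIntegral_const, smul_eq_mul, mul_comm]
    _ ≤ ∫ y in Metric.closedBall (x + p) τ,
          min 1 (π y / π x) * mixtureDensity qt qfix θ β s (y - x) := by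
        refine setIntegral_mono_on (integrableOn_const (by
          exact (isCompact_closedBall _ _).measure_lt_top.ne)) hint.integrableOn
          measurableSet_closedBall fun y hy => ?_
        obtain ⟨-, h1, h2⟩ := hball _ (hsub y hy)
        rw [add_sub_cancel] at h2
        exact mul_le_mul h2 ((mul_le_mul_of_nonneg_left h1 hβ.1.le).trans (hqle _))
          (mul_nonneg hβ.1.le hc) (hmin y)
    _ ≤ _ := by
        refine setIntegral_mono_set hint.integrableOn (ae_of_all _ hnn)
          (LE.le.eventuallyLE fun y hy => ?_)
        simpa using (hball _ (hsub y hy)).1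

/-! ### The variance recursion in a fixed direction -/

/-- In the recursion `v (k + 1) = (1 - a k) v k + a k (ζ k)²` with
`ζ (k + 1) = D (k + 1) + (1 - a k) ζ k`, an increment `|D k| ≥ δ` forces one of `|ζ k|`,
`|ζ (k - 1)|` to be at least `δ / 2`. If such increments, recorded by `I`, occur with conditional
frequency at least `ε`, then `v` is eventually bounded below, uniformly over all such
recursions driven by the same `I`. -/
lemma exists_forall_le_of_variance_recursion {a I p : ℕ → ℝ}
    (ha : ∀ n, a n ∈ Set.Ioo (0 : ℝ) 1) (ha_sum : ¬ Summable a)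
    (ha_zero : Tendsto a atTop (𝓝 0)) (ha_ratio : ∀ᶠ n in atTop, a (n + 1) ≤ 2 * a n)
    {l : ℝ} (hI : Tendsto (fun n => ∑ k ∈ Finset.range n, a k * (I k - p k)) atTop (𝓝 l))
    {ε δ : ℝ} (hε : 0 < ε) (hδ : 0 < δ) (hp : ∀ k, ε ≤ p k) (hI1 : ∀ k, I k ≤ 1) :
    ∃ N, ∀ v ζ D : ℕ → ℝ, (∀ k, 0 ≤ v k) →
      (∀ k, v (k + 1) = (1 - a k) * v k + a k * ζ k ^ 2) →
      (∀ k, ζ (k + 1) = D (k + 1) + (1 - a k) * ζ k) →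
      (∀ k, I k ≤ 0 ∨ δ ≤ |D k|) → ∀ n, N ≤ n → δ ^ 2 * ε / 64 ≤ v n := by
  have hhalf : ∀ᶠ n in atTop, a n ≤ 1 / 2 :=
    (ha_zero.eventually (gt_mem_nhds (by norm_num : (0 : ℝ) < 1 / 2))).mono fun n hn => hn.le
  obtain ⟨N₁, hN₁⟩ := eventually_atTop.1 (hhalf.and ha_ratio)
  have hξ : Tendsto (fun n => ∑ k ∈ Finset.range n, a k * (δ ^ 2 / 32 * (I k - p k))) atTop
      (𝓝 (δ ^ 2 / 32 * l)) := by
    refine (hI.const_mul (δ ^ 2 / 32)).congr fun n => ?_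
    rw [Finset.mul_sum]
    exact Finset.sum_congr rfl fun k _ => by ring
  obtain ⟨N, hN⟩ := exists_forall_half_le_of_recursion ha ha_sum hξ
    (by positivity : 0 < δ ^ 2 / 32 * ε) (N₁ + 1) (-(δ ^ 2 / 8))
  refine ⟨N + N₁ + 1, fun v ζ D hv hvrec hζ hID n hn => ?_⟩
  set z : ℕ → ℝ := fun k => min (ζ k ^ 2) (δ ^ 2 / 4) with hz
  have hz0 : ∀ k, 0 ≤ z k := fun k => le_min (sq_nonneg _) (by positivity)
  have hz1 : ∀ k, z k ≤ δ ^ 2 / 4 := fun k => min_le_right _ _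
  have hzζ : ∀ k, z k ≤ ζ k ^ 2 := fun k => min_le_left _ _
  have hz_ge : ∀ k, δ / 2 ≤ |ζ k| → δ ^ 2 / 4 ≤ z k := fun k hk => by
    refine le_min ?_ le_rfl
    have := pow_le_pow_left₀ (by positivity) hk 2
    rw [sq_abs] at this
    linarith
  have hpair : ∀ k, δ ^ 2 / 4 * I (k + 1) ≤ z (k + 1) + z k := by
    intro k
    rcases hID (k + 1) with h | h
    · nlinarith [hz0 k, hz0 (k + 1), sq_nonneg δ]
    · have h1 : δ ^ 2 / 4 * I (k + 1) ≤ δ ^ 2 / 4 := by nlinarith [hI1 (k + 1), sq_nonneg δ]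
      rcases le_total (δ / 2) |ζ k| with h2 | h2
      · linarith [hz_ge k h2, hz0 (k + 1)]
      · have h3 : |D (k + 1)| ≤ |ζ (k + 1)| + |ζ k| := by
          have h4 : D (k + 1) = ζ (k + 1) - (1 - a k) * ζ k := by rw [hζ]; ring
          have h5 : |(1 - a k) * ζ k| ≤ |ζ k| := by
            rw [abs_mul, abs_of_nonneg (by linarith [(ha k).2])]
            nlinarith [abs_nonneg (ζ k), (ha k).1]
          rw [h4]
          exact (abs_sub _ _).trans (by linarith)
        linarith [hz_ge (k + 1) (by linarith), hz0 k]
  -- subtracting half of the last increment distributes it over two consecutive steps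
  have hW := hN (fun k => v k - 1 / 2 * (a (k - 1) * z (k - 1))) (by
    have h1 := hv (N₁ + 1)
    have h2 := mul_le_mul (ha N₁).2.le (hz1 N₁) (hz0 N₁) zero_le_one
    simp only [add_tsub_cancel_right]
    linarith) (by
    intro k hk
    obtain ⟨j, rfl⟩ : ∃ j, k = j + 1 := ⟨k - 1, by omega⟩
    simp only [add_tsub_cancel_right]
    have h1 := (hN₁ (j + 1) (by omega)).1
    have h2 := (hN₁ j (by omega)).2
    have h3 := ha (j + 1)
    have h4 := mul_le_mul_of_nonneg_left (hpair j) h3.1.le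
    have h5 := mul_le_mul_of_nonneg_left (hzζ (j + 1)) h3.1.le
    have h6 : 1 / 4 * (a (j + 1) * z j) ≤ (1 - a (j + 1)) * (a j * z j) := by
      have h7 : 1 / 4 * a (j + 1) ≤ (1 - a (j + 1)) * a j := by nlinarith [(ha j).1]
      have := mul_le_mul_of_nonneg_right h7 (hz0 j)
      linarith
    have h8 := mul_le_mul_of_nonneg_left (hp (j + 1)) (mul_nonneg h3.1.le (sq_nonneg δ))
    have h9 := mul_nonneg h3.1.le (hz0 (j + 1))
    rw [hvrec (j + 1)]
    linarith) n (by omega)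
  have h1 := mul_nonneg (ha (n - 1)).1.le (hz0 (n - 1))
  linarith

/-! ### Moves of the chain in a fixed direction -/

/-- From a starting point `x` near `c`, the chain moves with probability at least `ε` to a
bounded region that is separated from `c` in the direction `w`. The region depends on `c`, not
on `x`, and all the constants are uniform. -/
lemma exists_le_metropolis_separated {π qt qfix : E d → ℝ} (hπ_meas : Measurable π)
    (hπ_bdd : ∃ C : ℝ, ∀ x, π x ≤ C)
    (hπ_pos : ∀ K : Set (E d), IsCompact K → ∃ c : ℝ, 0 < c ∧ ∀ x ∈ K, c ≤ π x)
    (hπ_reg : HasRegularContours π) (hqt : IsSymmetricDensity qt)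
    (hqfix : IsSymmetricDensity qfix)
    (hqfix_pos : ∃ c : ℝ, 0 < c ∧ ∀ᶠ z in 𝓝 (0 : E d), c ≤ qfix z)
    {θ β : ℝ} (hθ : 0 < θ) (hβ : β ∈ Set.Ioo (0 : ℝ) 1) :
    ∃ r δ ε : ℝ, 0 < r ∧ 0 < δ ∧ 0 < ε ∧ ∀ w : E d, ‖w‖ = 1 → ∀ s : Mat d, s.PosDef →
      ∀ c x : E d, dist x c ≤ δ →
        ε ≤ metropolis π (mixtureDensity qt qfix θ β s) x
          {y | 3 * δ ≤ |inner ℝ w (y - c)| ∧ ‖y - c‖ ≤ r} := by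
  obtain ⟨c₀, hc₀, hev⟩ := hqfix_pos
  obtain ⟨r₀, hr₀, hball⟩ := Metric.eventually_nhds_iff_ball.1 hev
  have hπ0 : ∀ x, 0 < π x := fun x => by
    obtain ⟨c', hc', h⟩ := hπ_pos {x} isCompact_singleton
    exact hc'.trans_le (h x rfl)
  obtain ⟨m, t, hm, ht, hacc⟩ := hπ_reg.exists_ball_le_min_div hπ_bdd hπ_pos
    (by positivity : 0 < r₀ / 2)
  -- the accepted ball leaves a gap `t / 4 = 4 δ` around the hyperplane through `x`, of which at
  -- least `3 δ` remain around the parallel hyperplane through `c`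
  refine ⟨r₀ / 2 + t / 16, t / 16, m * (β * c₀) * volume.real (Metric.closedBall (0 : E d) (t / 4)),
    by positivity, by positivity, ?_, fun w hw s hs c x hxc => ?_⟩
  · have h1 : 0 < volume.real (Metric.closedBall (0 : E d) (t / 4)) :=
      ENNReal.toReal_pos (Metric.measure_closedBall_pos _ _ (by positivity)).ne'
        (isCompact_closedBall _ _).measure_lt_top.ne
    have := hβ.1
    positivity
  · obtain ⟨p, hp⟩ := hacc x
    obtain ⟨p', hp'⟩ := exists_closedBall_subset_le_abs_inner p hw ht
    rw [dist_eq_norm] at hxc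
    have hin : |inner ℝ w (x - c)| ≤ t / 16 := by
      refine (abs_real_inner_le_norm _ _).trans ?_
      rwa [hw, one_mul]
    refine le_metropolis_mixtureDensity (p := p') hπ_meas hπ0 hqt hqfix hθ hβ hs ?_ hc₀.le ?_
    · rintro ⟨h1, -⟩
      linarith
    · intro z hz
      obtain ⟨h1, h2⟩ := hp' z hz
      obtain ⟨h3, h4⟩ := hp z h1
      have hdec : x + z - c = z + (x - c) := by abel
      refine ⟨⟨?_, ?_⟩, hball z (by rw [mem_ball_zero_iff]; linarith), h4⟩
      · rw [hdec, inner_add_right]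
        have h5 : |inner ℝ w z| ≤ |inner ℝ w z + inner ℝ w (x - c)| + |inner ℝ w (x - c)| := by
          have := abs_sub (inner ℝ w z + inner ℝ w (x - c)) (inner ℝ w (x - c))
          rwa [add_sub_cancel_right] at this
        linarith
      · rw [hdec]
        exact (norm_add_le _ _).trans (by linarith)

/-- A lower bound for a conditional probability of an event that also involves an
`m`-measurable variable `U` follows from bounds with `U` frozen at nearby points. -/
lemma ae_le_condExp_indicator_of_frozen {Ω F : Type*} {m m0 : MeasurableSpace Ω}
    {P : Measure Ω} [IsProbabilityMeasure P] (hm : m ≤ m0) [PseudoMetricSpace F]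
    [SecondCountableTopology F] [Nonempty F] [MeasurableSpace F] [BorelSpace F]
    {U Y : Ω → F} (hU : Measurable[m] U) (hY : Measurable Y) {A : F → Set F}
    (hA : ∀ c, MeasurableSet (A c)) {B : Set Ω} (hB : MeasurableSet B) {δ ε : ℝ} (hδ : 0 < δ)
    (hAB : ∀ c ω, dist (U ω) c ≤ δ → Y ω ∈ A c → ω ∈ B)
    (hle : ∀ c, ∀ᵐ ω ∂P, dist (U ω) c ≤ δ →
      ε ≤ P[(Y ⁻¹' A c).indicator (fun _ => (1 : ℝ))|m] ω) :
    ∀ᵐ ω ∂P, ε ≤ P[B.indicator (fun _ => (1 : ℝ))|m] ω := by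
  have hBint : Integrable (B.indicator (fun _ => (1 : ℝ))) P :=
    (integrable_const 1).indicator hB
  have hAint : ∀ c, Integrable ((Y ⁻¹' A c).indicator (fun _ => (1 : ℝ))) P := fun c =>
    (integrable_const 1).indicator (hY (hA c))
  have key : ∀ c, ∀ᵐ ω ∂P, dist (U ω) c ≤ δ → ε ≤ P[B.indicator (fun _ => (1 : ℝ))|m] ω := by
    intro c
    set D : Set Ω := U ⁻¹' Metric.closedBall c δ with hD
    have hDm : MeasurableSet[m] D := hU measurableSet_closedBall
    have h1 := condExp_indicator (hAint c) hDm
    have h2 := condExp_indicator hBint hDm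
    have h3 := condExp_mono (m := m) ((hAint c).indicator (hm _ hDm))
      (hBint.indicator (hm _ hDm)) (ae_of_all P fun ω => by
        by_cases hω : ω ∈ D
        · simp only [Set.indicator_of_mem hω]
          by_cases hωA : ω ∈ Y ⁻¹' A c
          · rw [Set.indicator_of_mem hωA, Set.indicator_of_mem (hAB c ω hω hωA)]
          · rw [Set.indicator_of_notMem hωA]
            exact Set.indicator_nonneg (fun _ _ => zero_le_one) _
        · simp only [Set.indicator_of_notMem hω, le_refl])
    filter_upwards [h1, h2, h3, hle c] with ω h1 h2 h3 h4 hω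
    have hωD : ω ∈ D := hω
    rw [h1, h2, Set.indicator_of_mem hωD, Set.indicator_of_mem hωD] at h3
    exact (h4 hω).trans h3
  filter_upwards [ae_all_iff.2 fun i => key (TopologicalSpace.denseSeq F i)] with ω hω
  obtain ⟨i, hi⟩ := (TopologicalSpace.denseRange_denseSeq F).exists_dist_lt (U ω) hδ
  exact hω i hi.le

lemma measurableSet_le_abs_inner_and_norm_le {Ω : Type*} {m : MeasurableSpace Ω} {U Y : Ω → E d}
    (hU : Measurable U) (hY : Measurable Y) (w : E d) (a b : ℝ) :
    MeasurableSet {ω | a ≤ |inner ℝ w (Y ω - U ω)| ∧ ‖Y ω - U ω‖ ≤ b} := by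
  have hsub := hY.sub hU
  have hin : Measurable fun ω => |inner ℝ w (Y ω - U ω)| :=
    (by fun_prop : Continuous fun y : E d => |inner ℝ w y|).measurable.comp hsub
  exact (measurableSet_le measurable_const hin).inter
    (measurableSet_le hsub.norm measurable_const)

/-! ### The Adaptive Metropolis process -/

namespace IsAMProcess

variable {Ω : Type*} {m0 : MeasurableSpace Ω} {P : Measure Ω} {π qt qfix : E d → ℝ} {θ β : ℝ}
  {η : ℕ → ℝ} {x₁ m₁ : E d} {s₁ : Mat d} {X M : ℕ → Ω → E d} {S : ℕ → Ω → Mat d}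

lemma posDef_S (h : IsAMProcess P π qt qfix θ β η x₁ m₁ s₁ X M S)
    (hη : ∀ n, 2 ≤ n → η n ∈ Set.Ioo (0 : ℝ) 1) (hs₁ : s₁.PosDef) (n : ℕ) (ω : Ω) :
    (S (n + 1) ω).PosDef := by
  induction n with
  | zero => rw [zero_add, h.init_S]; exact hs₁
  | succ n ih =>
    have h1 := hη (n + 1 + 1) (by omega)
    rw [h.step_S (n + 1) (by omega)]
    refine (ih.smul (by linarith [h1.2])).add_posSemidef (Matrix.PosSemidef.smul ?_ h1.1.le)
    simpa using Matrix.posSemidef_vecMulVec_self_star (X (n + 1 + 1) ω - M (n + 1) ω).ofLp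

lemma measurable_M (h : IsAMProcess P π qt qfix θ β η x₁ m₁ s₁ X M S) (n : ℕ) :
    Measurable (M (n + 1)) := by
  induction n with
  | zero =>
    rw [show M (0 + 1) = fun _ => m₁ from funext h.init_M]
    exact measurable_const
  | succ n ih =>
    have h1 : M (n + 1 + 1) = fun ω =>
        (1 - η (n + 1 + 1)) • M (n + 1) ω + η (n + 1 + 1) • X (n + 1 + 1) ω :=
      funext (h.step_M (n + 1) (by omega))
    rw [h1]
    exact (ih.const_smul (1 - η (n + 1 + 1))).add
      ((h.measurable_X (n + 1 + 1) (by omega)).const_smul (η (n + 1 + 1)))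

lemma measurable_S (h : IsAMProcess P π qt qfix θ β η x₁ m₁ s₁ X M S) (n : ℕ) (i j : Fin d) :
    Measurable fun ω => S (n + 1) ω i j := by
  induction n with
  | zero =>
    simp only [zero_add, h.init_S]
    exact measurable_const
  | succ n ih =>
    have h1 : ∀ k, Measurable fun ω => (X (n + 1 + 1) ω - M (n + 1) ω).ofLp k := fun k =>
      (EuclideanSpace.proj (𝕜 := ℝ) k).continuous.measurable.comp
        ((h.measurable_X (n + 1 + 1) (by omega)).sub (h.measurable_M n))
    have h2 : (fun ω => S (n + 1 + 1) ω i j) = fun ω => (1 - η (n + 1 + 1)) * S (n + 1) ω i j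
        + η (n + 1 + 1) * ((X (n + 1 + 1) ω - M (n + 1) ω).ofLp i
          * (X (n + 1 + 1) ω - M (n + 1) ω).ofLp j) := by
      ext ω
      rw [h.step_S (n + 1) (by omega)]
      simp [Matrix.vecMulVec_apply]
    rw [h2]
    exact (ih.const_mul _).add (((h1 i).mul (h1 j)).const_mul _)

lemma history_le (h : IsAMProcess P π qt qfix θ β η x₁ m₁ s₁ X M S) (n : ℕ) :
    history X M S n ≤ m0 := by
  refine iSup₂_le fun k hk => ?_
  have hk1 : 1 ≤ k := hk.1
  obtain ⟨j, rfl⟩ := Nat.exists_eq_add_of_le' hk1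
  refine Measurable.comap_le ((h.measurable_X _ hk1).prodMk ((h.measurable_M j).prodMk ?_))
  exact measurable_pi_lambda _ fun i => measurable_pi_lambda _ fun j' => h.measurable_S j i j'

/-- The filtration generated by the process, started at the time index `1`. -/
def filtration (h : IsAMProcess P π qt qfix θ β η x₁ m₁ s₁ X M S) : Filtration ℕ m0 where
  seq n := history X M S (n + 1)
  mono' _ _ hij := biSup_mono fun _ hk => ⟨hk.1, hk.2.trans (Nat.succ_le_succ hij)⟩
  le' n := h.history_le (n + 1)

end IsAMProcess

lemma measurable_history_X {Ω : Type*} (X M : ℕ → Ω → E d) (S : ℕ → Ω → Mat d) {k n : ℕ}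
    (hk : 1 ≤ k) (hkn : k ≤ n) : Measurable[history X M S n] (X k) := by
  have h1 : Measurable[MeasurableSpace.comap (fun ω => (X k ω, M k ω, fun i j => S k ω i j))
      (inferInstance : MeasurableSpace (E d × E d × (Fin d → Fin d → ℝ)))] (X k) :=
    measurable_fst.comp (comap_measurable _)
  exact h1.mono (le_iSup₂_of_le k ⟨hk, hkn⟩ le_rfl) le_rfl

lemma dotProduct_mulVec_add_vecMulVec (w u : E d) (s : Mat d) (a b : ℝ) :
    w.ofLp ⬝ᵥ ((a • s + b • Matrix.vecMulVec u.ofLp u.ofLp) *ᵥ w.ofLp)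
      = a * (w.ofLp ⬝ᵥ (s *ᵥ w.ofLp)) + b * inner ℝ w u ^ 2 := by
  have h1 : inner ℝ w u = u.ofLp ⬝ᵥ w.ofLp := by
    rw [EuclideanSpace.inner_eq_star_dotProduct]; simp
  rw [Matrix.add_mulVec, Matrix.smul_mulVec, Matrix.smul_mulVec, dotProduct_add, dotProduct_smul,
    dotProduct_smul, Matrix.vecMulVec_mulVec, dotProduct_smul, h1, dotProduct_comm w.ofLp u.ofLp]
  simp only [smul_eq_mul, op_smul_eq_smul]
  ring

namespace IsAMProcess

variable {Ω : Type*} {m0 : MeasurableSpace Ω} {P : Measure Ω} [IsProbabilityMeasure P]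
  {π qt qfix : E d → ℝ} {θ β : ℝ}
  {η : ℕ → ℝ} {x₁ m₁ : E d} {s₁ : Mat d} {X M : ℕ → Ω → E d} {S : ℕ → Ω → Mat d}

/-- Given the past, the chain moves in the direction `w` by at least `2 δ`, within distance
`r`, with probability at least `ε`. -/
lemma ae_le_condExp_move (h : IsAMProcess P π qt qfix θ β η x₁ m₁ s₁ X M S)
    (hη : ∀ n, 2 ≤ n → η n ∈ Set.Ioo (0 : ℝ) 1) (hs₁ : s₁.PosDef) {r δ ε : ℝ} (hδ : 0 < δ)
    {w : E d} (hw : ‖w‖ = 1)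
    (hker : ∀ s : Mat d, s.PosDef → ∀ c x : E d, dist x c ≤ δ →
        ε ≤ metropolis π (mixtureDensity qt qfix θ β s) x
          {y | 3 * δ ≤ |inner ℝ w (y - c)| ∧ ‖y - c‖ ≤ r}) (n : ℕ) :
    ∀ᵐ ω ∂P, ε ≤ P[{ω | 2 * δ ≤ |inner ℝ w (X (n + 2) ω - X (n + 1) ω)|
      ∧ ‖X (n + 2) ω - X (n + 1) ω‖ ≤ r + δ}.indicator (fun _ => (1 : ℝ))|h.filtration n] ω := by
  have hX1 := h.measurable_X (n + 1) (by omega)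
  have hX2 := h.measurable_X (n + 2) (by omega)
  have hA : ∀ c : E d, MeasurableSet {y | 3 * δ ≤ |inner ℝ w (y - c)| ∧ ‖y - c‖ ≤ r} := fun c =>
    measurableSet_le_abs_inner_and_norm_le (measurable_const (a := c)) measurable_id w _ _
  refine ae_le_condExp_indicator_of_frozen (h.filtration.le n)
    (measurable_history_X X M S (by omega) le_rfl) hX2 hA
    (measurableSet_le_abs_inner_and_norm_le hX1 hX2 w _ _) hδ ?_ ?_
  · rintro c ω hc ⟨h1, h2⟩
    rw [dist_eq_norm] at hc
    have hin : |inner ℝ w (X (n + 1) ω - c)| ≤ δ := by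
      refine (abs_real_inner_le_norm _ _).trans ?_
      rwa [hw, one_mul]
    have hdec : X (n + 2) ω - X (n + 1) ω = X (n + 2) ω - c - (X (n + 1) ω - c) := by abel
    refine ⟨?_, ?_⟩
    · rw [hdec, inner_sub_right]
      have := abs_sub_abs_le_abs_sub (inner ℝ w (X (n + 2) ω - c)) (inner ℝ w (X (n + 1) ω - c))
      linarith
    · rw [hdec]
      exact (norm_sub_le _ _).trans (add_le_add h2 hc)
  · intro c
    filter_upwards [h.step_X (n + 1) (by omega) _ (hA c)] with ω hω hc
    exact (hker _ (h.posDef_S hη hs₁ n ω) c _ hc).trans_eq hω.symm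

/-- Almost surely, the quadratic forms of the covariances are eventually bounded below by a
deterministic positive constant, uniformly over the unit sphere. -/
lemma exists_ae_eventually_le (h : IsAMProcess P π qt qfix θ β η x₁ m₁ s₁ X M S)
    (hη : ∀ n, 2 ≤ n → η n ∈ Set.Ioo (0 : ℝ) 1)
    (hη_ratio : Tendsto (fun n => η (n + 1) / η n) atTop (𝓝 1))
    (hη_sum : ¬ Summable (fun n => η (n + 2)))
    (hη_sq : Summable (fun n => η (n + 2) ^ 2)) (hs₁ : s₁.PosDef)
    {r δ ε : ℝ} (hr : 0 < r) (hδ : 0 < δ) (hε : 0 < ε)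
    (hker : ∀ w : E d, ‖w‖ = 1 → ∀ s : Mat d, s.PosDef → ∀ c x : E d, dist x c ≤ δ →
        ε ≤ metropolis π (mixtureDensity qt qfix θ β s) x
          {y | 3 * δ ≤ |inner ℝ w (y - c)| ∧ ‖y - c‖ ≤ r}) :
    ∀ᵐ ω ∂P, ∀ᶠ n in atTop, ∀ w : E d, ‖w‖ = 1 →
      δ ^ 2 * ε / 64 ≤ w.ofLp ⬝ᵥ (S n ω *ᵥ w.ofLp) := by
  set a : ℕ → ℝ := fun n => η (n + 2) with ha_def
  have ha : ∀ n, a n ∈ Set.Ioo (0 : ℝ) 1 := fun n => hη _ (by omega)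
  have ha_zero : Tendsto a atTop (𝓝 0) := by
    have h1 := hη_sq.tendsto_atTop_zero.sqrt
    rw [Real.sqrt_zero] at h1
    exact h1.congr fun n => Real.sqrt_sq (ha n).1.le
  have ha_ratio : ∀ᶠ n in atTop, a (n + 1) ≤ 2 * a n := by
    have h1 : Tendsto (fun n => a (n + 1) / a n) atTop (𝓝 1) :=
      hη_ratio.comp (tendsto_add_atTop_nat 2)
    filter_upwards [h1.eventually (gt_mem_nhds (by norm_num : (1 : ℝ) < 2))] with n hn
    exact ((div_lt_iff₀ (ha n).1).1 hn).le
  obtain ⟨t, hts, htf, htc⟩ := (isCompact_sphere (0 : E d) 1).finite_cover_balls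
    (by positivity : 0 < δ / (r + δ))
  set B : E d → ℕ → Set Ω := fun w n => {ω | 2 * δ ≤ |inner ℝ w (X (n + 2) ω - X (n + 1) ω)|
      ∧ ‖X (n + 2) ω - X (n + 1) ω‖ ≤ r + δ} with hB
  set f : E d → ℕ → Ω → ℝ := fun w n => (B w n).indicator (fun _ => (1 : ℝ)) with hf
  have hfm : ∀ w n, StronglyMeasurable[h.filtration (n + 1)] (f w n) := fun w n =>
    stronglyMeasurable_const.indicator (measurableSet_le_abs_inner_and_norm_le
      (measurable_history_X X M S (by omega) (by omega))
      (measurable_history_X X M S (by omega) (by omega)) w _ _)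
  have hf0 : ∀ w n ω, 0 ≤ f w n ω := fun w n ω =>
    Set.indicator_nonneg (fun _ _ => zero_le_one) ω
  have hf1 : ∀ w n ω, f w n ω ≤ 1 := fun w n ω =>
    Set.indicator_le_self' (fun _ _ => zero_le_one) ω
  have hconv : ∀ᵐ ω ∂P, ∀ w ∈ t, ∃ l, Tendsto (fun n => ∑ k ∈ Finset.range n,
      a k * (f w k ω - P[f w k|h.filtration k] ω)) atTop (𝓝 l) :=
    (ae_ball_iff htf.countable).2 fun w _ => ae_exists_tendsto_sum_sub_condExp h.filtration
      (hfm w) (fun n ω => by rw [abs_of_nonneg (hf0 w n ω)]; exact hf1 w n ω) hη_sq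
  have hprob : ∀ᵐ ω ∂P, ∀ w ∈ t, ∀ k, ε ≤ P[f w k|h.filtration k] ω :=
    (ae_ball_iff htf.countable).2 fun w hw => ae_all_iff.2 fun k =>
      have hw1 : ‖w‖ = 1 := mem_sphere_zero_iff_norm.1 (hts hw)
      h.ae_le_condExp_move hη hs₁ hδ hw1 (hker w hw1) k
  filter_upwards [hconv, hprob] with ω hconv hprob
  have hnet : ∀ w' ∈ t, ∀ᶠ n in atTop, ∀ w : E d, ‖w‖ = 1 → dist w w' < δ / (r + δ) →
      δ ^ 2 * ε / 64 ≤ w.ofLp ⬝ᵥ (S (n + 1) ω *ᵥ w.ofLp) := by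
    intro w' hw'
    obtain ⟨l, hl⟩ := hconv w' hw'
    obtain ⟨N, hN⟩ := exists_forall_le_of_variance_recursion ha hη_sum ha_zero ha_ratio hl hε hδ
      (hprob w' hw') (fun k => hf1 w' k ω)
    refine eventually_atTop.2 ⟨N, fun n hn w hw hww' => ?_⟩
    refine hN (fun k => w.ofLp ⬝ᵥ (S (k + 1) ω *ᵥ w.ofLp))
      (fun k => inner ℝ w (X (k + 2) ω - M (k + 1) ω))
      (fun k => inner ℝ w (X (k + 2) ω - X (k + 1) ω)) (fun k => ?_) (fun k => ?_) (fun k => ?_)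
      (fun k => ?_) n hn
    · simpa using (h.posDef_S hη hs₁ k ω).posSemidef.dotProduct_mulVec_nonneg w.ofLp
    · rw [h.step_S (k + 1) (by omega), dotProduct_mulVec_add_vecMulVec]
    · rw [h.step_M (k + 1) (by omega), ← inner_smul_right, ← inner_add_right]
      congr 1
      simp only [ha_def]
      module
    · by_cases hω : ω ∈ B w' k
      · right
        obtain ⟨h1, h2⟩ := hω
        have h3 : |inner ℝ (w' - w) (X (k + 2) ω - X (k + 1) ω)| ≤ δ := by
          refine (abs_real_inner_le_norm _ _).trans ?_
          rw [dist_comm, dist_eq_norm] at hww'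
          have := mul_le_mul hww'.le h2 (norm_nonneg _) (by positivity)
          rwa [div_mul_cancel₀ _ (by positivity)] at this
        rw [inner_sub_left] at h3
        have h4 := abs_sub_abs_le_abs_sub (inner ℝ w' (X (k + 2) ω - X (k + 1) ω))
          (inner ℝ w (X (k + 2) ω - X (k + 1) ω))
        linarith
      · left
        exact (Set.indicator_of_notMem hω _).le
  rw [← map_add_atTop_eq_nat 1, eventually_map]
  filter_upwards [(htf.eventually_all).2 hnet] with n hn w hw
  obtain ⟨w', hw', hball⟩ := Set.mem_iUnion₂.1 (htc (mem_sphere_zero_iff_norm.2 hw))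
  exact hn w' hw' w hw hball

end IsAMProcess

end AdaptiveMetropolis

/-! ### Almost sure non-degeneracy of the covariances -/

theorem mainTheorem5 {d : ℕ} {Ω : Type*} [MeasurableSpace Ω]
    (P : Measure Ω) [IsProbabilityMeasure P]
    -- the target density
    (π : AdaptiveMetropolis.E d → ℝ) (hπ_meas : Measurable π)
    (hπ_bdd : ∃ C : ℝ, ∀ x, π x ≤ C)
    (hπ_pos : ∀ K : Set (AdaptiveMetropolis.E d), IsCompact K → ∃ c : ℝ, 0 < c ∧ ∀ x ∈ K, c ≤ π x)
    (hπ_reg : AdaptiveMetropolis.HasRegularContours π)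
    -- the proposal
    (qt qfix : AdaptiveMetropolis.E d → ℝ)
    (hqt : AdaptiveMetropolis.IsSymmetricDensity qt)
    (hqfix : AdaptiveMetropolis.IsSymmetricDensity qfix)
    (hqfix_pos : ∃ c : ℝ, 0 < c ∧ ∀ᶠ z in 𝓝 (0 : AdaptiveMetropolis.E d), c ≤ qfix z)
    (θ : ℝ) (hθ : 0 < θ) (β : ℝ) (hβ : β ∈ Set.Ioo (0 : ℝ) 1)
    -- the adaptation weights
    (η : ℕ → ℝ) (hη : ∀ n, 2 ≤ n → η n ∈ Set.Ioo (0 : ℝ) 1)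
    (hη_ratio : Tendsto (fun n => η (n + 1) / η n) atTop (𝓝 1))
    (hη_sum : ¬ Summable (fun n => η (n + 2)))
    (hη_sq : Summable (fun n => η (n + 2) ^ 2))
    -- the process
    (x₁ m₁ : AdaptiveMetropolis.E d) (s₁ : AdaptiveMetropolis.Mat d) (hs₁ : s₁.PosDef)
    (X M : ℕ → Ω → AdaptiveMetropolis.E d) (S : ℕ → Ω → AdaptiveMetropolis.Mat d)
    (hAM : AdaptiveMetropolis.IsAMProcess P π qt qfix θ β η x₁ m₁ s₁ X M S) :
    ∀ᵐ ω ∂P,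
      0 < liminf (fun n : ℕ =>
        ⨅ w : Metric.sphere (0 : AdaptiveMetropolis.E d) 1,
          ((w.1.ofLp ⬝ᵥ (S n ω *ᵥ w.1.ofLp) : ℝ) : EReal)) atTop := by
  obtain ⟨r, δ, ε, hr, hδ, hε, hker⟩ := AdaptiveMetropolis.exists_le_metropolis_separated hπ_meas
    hπ_bdd hπ_pos hπ_reg hqt hqfix hqfix_pos hθ hβ
  filter_upwards [hAM.exists_ae_eventually_le hη hη_ratio hη_sum hη_sq hs₁ hr hδ hε hker] with ω hω
  have hpos : (0 : EReal) < ((δ ^ 2 * ε / 64 : ℝ) : EReal) := by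
    exact_mod_cast (by positivity : 0 < δ ^ 2 * ε / 64)
  refine hpos.trans_le (le_liminf_of_le (by isBoundedDefault) ?_)
  filter_upwards [hω] with n hn
  exact le_iInf fun w => EReal.coe_le_coe_iff.2 (hn w.1 (mem_sphere_zero_iff_norm.1 w.2))
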